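/- Let $n,d\ge 0$ be integers, let $S^n\subset\mathbb R^{n+1}$ be the unit sphere, and let $\mathcal P_{n,d}=\mathbb R[x_0,\dots,x_n]_{(d)}$ be the space of real homogeneous polynomials of degree $d$ with the Bombieri–Weil norm $$\Big\|\sum_{|\alpha|=d}\gamma_\alpha x^\alpha\Big\|_{\mathrm{BW}}=\Big(\sum_{|\alpha|=d}\gamma_\alpha^2\,\frac{\alpha_0!\cdots\alpha_n!}{d!}\Big)^{1/2}.$$ Let $\mathcal S_{n,d}=\mathcal P_{n,d}|_{S^n}$. Restriction $P\mapsto p=P|_{S^n}$ identifies $\mathcal P_{n,d}$ with $\mathcal S_{n,d}$, and we put $\|p\|_{\mathrm{BW}}=\|P\|_{\mathrm{BW}}$. For $f\in C^1(S^n,\mathbb R)$ let $\nabla_{S^n}f$ be its spherical gradient, $Z(f)=\{x\in S^n: f(x)=0\}$, and $$\|f\|_{C^1}=\max_{\theta\in S^n}|f(\theta)|+\max_{\theta\in S^n}\|\nabla_{S^n}f(\theta)\|.$$ Let $$\Sigma_{n,d}=\{s\in\mathcal S_{n,d}:\ \exists x\in S^n,\ s(x)=0,\ \nabla_{S^n}s(x)=0\},\qquad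 \delta(p)=\inf_{s\in\Sigma_{n,d}}\|s-p\|_{\mathrm{BW}}$$ be the discriminant and the Bombieri–Weil distance of $p$ to it (the infimum is attained). Let $p\in\mathcal S_{n,d}\setminus\Sigma_{n,d}$ and let $f\in C^1(S^n,\mathbb R)$ satisfy $\|f-p\|_{C^1}<\delta(p)/2$. Then the pairs $(S^n,Z(p))$ and $(S^n,Z(f))$ are diffeomorphic: there is a $C^1$-diffeomorphism $\varphi:S^n\to S^n$ with $\varphi(Z(p))=Z(f)$. More precisely, whenever $1\le k\le\infty$ and $f$ is of class $C^k$, the diffeomorphism $\varphi$ can be chosen of class $C^k$. -/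

import Mathlib

open scoped Manifold ContDiff

noncomputable section

namespace KostlanStability

/-- The Euclidean space `ℝⁿ⁺¹`. -/
abbrev Ambient (n : ℕ) : Type := EuclideanSpace ℝ (Fin (n + 1))

/-- The unit sphere `Sⁿ ⊂ ℝⁿ⁺¹`, with Mathlib's smooth manifold structure modelled on `ℝⁿ`. -/
abbrev Sph (n : ℕ) : Type := Metric.sphere (0 : Ambient n) 1

/-- The space of real homogeneous polynomials of degree `d` in `x₀, …, xₙ`. -/
abbrev HomPoly (n d : ℕ) : Submodule ℝ (MvPolynomial (Fin (n + 1)) ℝ) :=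
  MvPolynomial.homogeneousSubmodule (Fin (n + 1)) ℝ d

/-- The restriction `p = P|_{Sⁿ}`. -/
def restrict {n : ℕ} (P : MvPolynomial (Fin (n + 1)) ℝ) : Sph n → ℝ :=
  fun x => MvPolynomial.eval (fun i => (x : Ambient n) i) P

/-- The Bombieri-Weil norm of the degree `d` homogeneous polynomial `∑ γ_α x^α`,
namely `(∑ γ_α² α₀! ⋯ αₙ! / d!)^{1/2}`. -/
def bwNorm {n d : ℕ} (P : HomPoly n d) : ℝ :=
  Real.sqrt (∑ α ∈ (P : MvPolynomial (Fin (n + 1)) ℝ).support,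
    ((P : MvPolynomial (Fin (n + 1)) ℝ).coeff α) ^ 2 *
      ((∏ i, ((α i).factorial : ℝ)) / (d.factorial : ℝ)))

/-- The extension of a function on the sphere to `ℝⁿ⁺¹ ∖ {0}` that is constant along rays,
`y ↦ f (y / ‖y‖)`, with the irrelevant value `0` at the origin. -/
def radialExtension {n : ℕ} (f : Sph n → ℝ) : Ambient n → ℝ := fun y =>
  if hy : y ≠ 0 then
    f ⟨‖y‖⁻¹ • y, by
      simp [norm_smul, inv_mul_cancel₀ (norm_ne_zero_iff.mpr hy)]⟩
  else 0

/-- The spherical gradient of `f : Sⁿ → ℝ`, as a vector of `ℝⁿ⁺¹` (tangent to the sphere):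
the Euclidean gradient of the extension of `f` that is constant along rays. For the restriction
of a function defined near the sphere it is the tangential part of the Euclidean gradient,
see `sphGrad_restriction`. -/
def sphGrad {n : ℕ} (f : Sph n → ℝ) (x : Sph n) : Ambient n :=
  gradient (radialExtension f) (x : Ambient n)

/-- The spherical gradient of a restriction is the orthogonal projection of the Euclidean
gradient to the tangent space of the sphere. -/
theorem sphGrad_restriction {n : ℕ} (F : Ambient n → ℝ) (x : Sph n)
    (hF : DifferentiableAt ℝ F (x : Ambient n)) :
    sphGrad (fun y : Sph n => F y) x =
      gradient F (x : Ambient n) - (inner ℝ (x : Ambient n) (gradient F (x : Ambient n))) •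
        (x : Ambient n) := by
  have hx1 : ‖(x : Ambient n)‖ = 1 := by simp
  have hx0 : (x : Ambient n) ≠ 0 := by
    intro h
    simp [h] at hx1
  have hev : radialExtension (fun y : Sph n => F y) =ᶠ[nhds (x : Ambient n)]
      fun y => F (‖y‖⁻¹ • y) := by
    filter_upwards [isOpen_ne.mem_nhds hx0] with y hy
    have hy' : y ≠ 0 := hy
    simp [radialExtension, hy']
  have hn : HasFDerivAt (fun y : Ambient n => ‖y‖) (innerSL ℝ (x : Ambient n))
      (x : Ambient n) := by
    have h1 : HasFDerivAt (fun y : Ambient n => ‖y‖ ^ 2) (2 • innerSL ℝ (x : Ambient n))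
        (x : Ambient n) := (hasStrictFDerivAt_norm_sq (x : Ambient n)).hasFDerivAt
    have h2 := h1.sqrt (by simp)
    simp only [Real.sqrt_sq (norm_nonneg _), hx1] at h2
    refine h2.congr_fderiv ?_
    apply ContinuousLinearMap.ext
    intro v
    simp
  have hi : HasFDerivAt (fun y : Ambient n => ‖y‖⁻¹) (-innerSL ℝ (x : Ambient n))
      (x : Ambient n) := by
    have h := (hasDerivAt_inv (norm_ne_zero_iff.mpr hx0)).comp_hasFDerivAt _ hn
    refine HasFDerivAt.congr_fderiv (f := fun y : Ambient n => ‖y‖⁻¹) h ?_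
    apply ContinuousLinearMap.ext
    intro v
    simp
  have hs : HasFDerivAt (fun y : Ambient n => ‖y‖⁻¹ • y) _ (x : Ambient n) :=
    hi.smul (hasFDerivAt_id (x : Ambient n))
  have hF' : HasFDerivAt F (fderiv ℝ F (x : Ambient n))
      ((fun y : Ambient n => ‖y‖⁻¹ • y) (x : Ambient n)) := by
    simpa [hx1] using hF.hasFDerivAt
  have hc : HasFDerivAt (fun y : Ambient n => F (‖y‖⁻¹ • y)) _ (x : Ambient n) :=
    HasFDerivAt.comp (x : Ambient n) hF' hs
  have hfd := hev.fderiv_eq.trans hc.fderiv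
  apply ext_inner_right ℝ
  intro v
  unfold sphGrad gradient
  rw [InnerProductSpace.toDual_symm_apply, hfd]
  rw [inner_sub_left, InnerProductSpace.toDual_symm_apply, inner_smul_left,
    real_inner_comm, InnerProductSpace.toDual_symm_apply]
  simp [hx1]
  ring

/-- The zero set `Z(f) ⊂ Sⁿ`. -/
def zeroSet {n : ℕ} (f : Sph n → ℝ) : Set (Sph n) := {x | f x = 0}

/-- The `C¹`-norm `max |f| + max ‖∇_{Sⁿ} f‖`, for `f` of class `C¹` (so that both suprema,
over a compact space, are maxima). -/
def c1Norm {n : ℕ} (f : Sph n → ℝ) : ℝ := (⨆ x, |f x|) + ⨆ x, ‖sphGrad f x‖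

/-- The discriminant: homogeneous polynomials of degree `d` whose zero set on `Sⁿ` is singular. -/
def discriminant (n d : ℕ) : Set (HomPoly n d) :=
  {P | ∃ x : Sph n, restrict (P : MvPolynomial (Fin (n + 1)) ℝ) x = 0 ∧
    sphGrad (restrict (P : MvPolynomial (Fin (n + 1)) ℝ)) x = 0}

theorem zero_mem_discriminant (n d : ℕ) : (0 : HomPoly n d) ∈ discriminant n d := by
  refine ⟨⟨EuclideanSpace.single 0 1, by simp⟩, by simp [restrict], ?_⟩
  have h := sphGrad_restriction (n := n) (fun _ => (0 : ℝ))
    ⟨EuclideanSpace.single 0 1, by simp⟩ (differentiableAt_const _)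
  have h0 : restrict ((0 : HomPoly n d) : MvPolynomial (Fin (n + 1)) ℝ) =
      fun _ : Sph n => (0 : ℝ) := by
    funext x
    simp [restrict]
  rw [h0]
  simpa [gradient] using h

/-- The Bombieri-Weil distance from `P` to the discriminant (a non-empty set, as it contains `0`). -/
def discDist {n d : ℕ} (P : HomPoly n d) : ℝ :=
  sInf ((fun S : HomPoly n d => bwNorm (S - P)) '' discriminant n d)

/-- The pairs `(Sⁿ, Z₁)` and `(Sⁿ, Z₂)` are diffeomorphic by a diffeomorphism of class `C^k`. -/
def DiffeomorphicPairs {n : ℕ} (k : ℕ∞) (Z₁ Z₂ : Set (Sph n)) : Prop :=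
  ∃ φ : Diffeomorph (𝓡 n) (𝓡 n) (Sph n) (Sph n) (k : WithTop ℕ∞), φ '' Z₁ = Z₂

end KostlanStability

end

open KostlanStability

/-! Two facts carry the proof. The metric one is `discDist_le_abs_add_norm_sphGrad`: δ(p) ≤ |p(x)| +
‖∇p(x)‖ at every x. With a = p(x) and g = ∇p(x), the form T = ⟨x,·⟩^(d-1) ⟨a x + g,·⟩ has the same
1-jet at x as p, so p - T lies in the discriminant, and `bwNorm_mul_linForm_le` bounds its norm by
‖a x + g‖ ≤ |a| + ‖g‖. If some p + t(f - p) with 0 ≤ t ≤ 1 had a singular zero x, the 1-jet of p at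
x would be bounded by that of f - p, giving δ(p) ≤ ‖f - p‖, a contradiction. The topological one is
`diffeomorphicPairs_of_segment`: along a segment without singular zeros the zero set keeps its
diffeomorphism type. Integrating a gradient-type vector field could lose a derivative, so C^k
regularity is obtained from the inverse function theorem instead. Near a regular point a shear y ↦ y
+ α(y) w straightens a function to a linear form, and composing one shear with the inverse of
another carries a function to its perturbation. A partition of unity and connectedness of [0,1] make
this global. -/

namespace KostlanStability

open Set Filter Topology
open scoped NNReal

/-! ### Shears along a fixed vector -/

section Shear

variable {E : Type*} [NormedAddCommGroup E] [NormedSpace ℝ E] [CompleteSpace E]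

/-- A Lipschitz perturbation of the identity in the direction `w` is a homeomorphism. -/
theorem exists_shear_homeomorph {α : E → ℝ} {c : ℝ≥0} (hα : LipschitzWith c α) {w : E}
    (hc : c * ‖w‖₊ < 1) : ∃ L : E ≃ₜ E, ∀ y, L y = y + α y • w := by
  have h : ApproximatesLinearOn (fun y => y + α y • w)
      ((ContinuousLinearEquiv.refl ℝ E : E ≃L[ℝ] E) : E →L[ℝ] E) univ (c * ‖w‖₊) := by
    intro x _ y _
    have h1 : x + α x • w - (y + α y • w) -
        ((ContinuousLinearEquiv.refl ℝ E : E ≃L[ℝ] E) : E →L[ℝ] E) (x - y) =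
        (α x - α y) • w := by
      simp only [ContinuousLinearEquiv.coe_refl, ContinuousLinearMap.coe_id', id_eq, sub_smul]
      abel
    rw [h1, norm_smul]
    have h2 := hα.dist_le_mul x y
    rw [dist_eq_norm, dist_eq_norm] at h2
    calc ‖α x - α y‖ * ‖w‖ ≤ (c * ‖x - y‖) * ‖w‖ := by gcongr
      _ = _ := by push_cast; ring
  refine ⟨h.toHomeomorph _ ?_, fun y => rfl⟩
  -- The identity has norm 1 only on a nontrivial space.
  rcases subsingleton_or_nontrivial E with hE | hE
  · exact Or.inl hE
  · right
    have : ‖((ContinuousLinearEquiv.refl ℝ E).symm : E →L[ℝ] E)‖₊ = 1 := by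
      simp
    rw [this, inv_one]
    exact hc

/-- The derivative of the shear is the identity plus an operator of norm at most `c * ‖w‖ < 1`,
hence invertible by the Neumann series; the inverse function theorem applies. -/
theorem contDiffAt_shear_symm {α : E → ℝ} {c : ℝ≥0} (hα : LipschitzWith c α) {w : E}
    (hc : c * ‖w‖₊ < 1) {L : E ≃ₜ E} (hL : ∀ y, L y = y + α y • w) {k : WithTop ℕ∞}
    (hk : 1 ≤ k) {y : E} (hy : ContDiffAt ℝ k α y) : ContDiffAt ℝ k L.symm (L y) := by
  have hLf : (L : E → E) = fun y => y + α y • w := funext hL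
  have hd : HasFDerivAt α (fderiv ℝ α y) y :=
    (hy.differentiableAt (zero_lt_one.trans_le hk).ne').hasFDerivAt
  set t : E →L[ℝ] E := -(fderiv ℝ α y).smulRight w with ht
  have hn : ‖t‖ < 1 := by
    rw [ht, norm_neg, ContinuousLinearMap.norm_smulRight_apply]
    calc ‖fderiv ℝ α y‖ * ‖w‖ ≤ c * ‖w‖ := by
          gcongr
          exact norm_fderiv_le_of_lipschitz ℝ hα
      _ < 1 := by exact_mod_cast hc
  let e : E ≃L[ℝ] E := ContinuousLinearEquiv.ofUnit (Units.oneSub t hn)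
  have he : (e : E →L[ℝ] E) = ContinuousLinearMap.id ℝ E + (fderiv ℝ α y).smulRight w := by
    ext v
    change ((1 : E →L[ℝ] E) - t) v = _
    simp [ht]
  have hsymm : L.symm (L y) = y := L.symm_apply_apply y
  refine L.toOpenPartialHomeomorph.contDiffAt_symm (f₀' := e) (mem_univ _) ?_ ?_
  · change HasFDerivAt L (e : E →L[ℝ] E) (L.symm (L y))
    rw [hsymm, he, hLf]
    exact (hasFDerivAt_id y).add (hd.smul_const w)
  · change ContDiffAt ℝ k L (L.symm (L y))
    rw [hsymm, hLf]
    exact contDiffAt_id.add (hy.smul contDiffAt_const)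

/-- Two Lipschitz perturbations of the identity which agree off `K` differ by a diffeomorphism
supported in `K`. -/
theorem exists_homeomorph_of_shears {α β : E → ℝ} {c : ℝ≥0} (hα : LipschitzWith c α)
    (hβ : LipschitzWith c β) {w : E} (hc : c * ‖w‖₊ < 1) {K B : Set E} (hK : IsClosed K)
    (hB : IsOpen B) (hKB : K ⊆ B) {k : WithTop ℕ∞} (hk : 1 ≤ k) (hαB : ContDiffOn ℝ k α B)
    (hβB : ContDiffOn ℝ k β B) (hαβ : ∀ y ∉ K, α y = β y) :
    ∃ Φ : E ≃ₜ E, (∀ y, Φ y + β (Φ y) • w = y + α y • w) ∧ ContDiff ℝ k Φ ∧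
      ContDiff ℝ k Φ.symm ∧ (∀ y ∉ K, Φ y = y) ∧ ∀ y ∈ K, Φ y ∈ K := by
  obtain ⟨A, hA⟩ := exists_shear_homeomorph hα hc
  obtain ⟨C, hC⟩ := exists_shear_homeomorph hβ hc
  -- The diffeomorphism is C⁻¹ ∘ A. The shears are known to be C^k only on `B`; this is enough,
  -- since off the closed set `K` the map is locally the identity.
  have hfix : ∀ y ∉ K, A.trans C.symm y = y := by
    intro y hy
    rw [Homeomorph.trans_apply, Homeomorph.symm_apply_eq, hA, hC, hαβ y hy]
  have hfix' : ∀ y ∉ K, (A.trans C.symm).symm y = y := by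
    intro y hy
    rw [Homeomorph.symm_apply_eq, hfix y hy]
  have hmaps : ∀ y ∈ K, A.trans C.symm y ∈ K := by
    intro y hy
    by_contra hn
    have h := hfix _ hn
    rw [(A.trans C.symm).injective h] at hn
    exact hn hy
  have hmaps' : ∀ y ∈ K, (A.trans C.symm).symm y ∈ K := by
    intro y hy
    by_contra hn
    have h := hfix' _ hn
    rw [(A.trans C.symm).symm.injective h] at hn
    exact hn hy
  have smooth : ∀ {α : E → ℝ}, ContDiffOn ℝ k α B → ∀ y ∈ K, ContDiffAt ℝ k α y :=
    fun h y hy => h.contDiffAt (hB.mem_nhds (hKB hy))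
  have shear : ∀ {α : E → ℝ} {L : E ≃ₜ E}, (∀ y, L y = y + α y • w) → ContDiffOn ℝ k α B →
      ∀ y ∈ K, ContDiffAt ℝ k L y := by
    intro α L hL h y hy
    rw [show (L : E → E) = fun y => y + α y • w from funext hL]
    exact contDiffAt_id.add ((smooth h y hy).smul contDiffAt_const)
  have off : ∀ {Φ : E ≃ₜ E}, (∀ y ∉ K, Φ y = y) → ∀ y ∉ K, ContDiffAt ℝ k Φ y := by
    intro Φ hΦ y hy
    refine contDiffAt_id.congr_of_eventuallyEq ?_
    filter_upwards [hK.isOpen_compl.mem_nhds hy] with z hz using hΦ z hz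
  refine ⟨A.trans C.symm, fun y => ?_, contDiff_iff_contDiffAt.2 fun y => ?_,
    contDiff_iff_contDiffAt.2 fun y => ?_, hfix, hmaps⟩
  · rw [← hC, Homeomorph.trans_apply, Homeomorph.apply_symm_apply, hA]
  · by_cases hy : y ∈ K
    · have h1 := contDiffAt_shear_symm hβ hc hC hk (smooth hβB _ (hmaps y hy))
      rw [Homeomorph.trans_apply, Homeomorph.apply_symm_apply] at h1
      exact h1.comp y (shear hA hαB y hy)
    · exact off hfix y hy
  · by_cases hy : y ∈ K
    · have h1 := contDiffAt_shear_symm hα hc hA hk (smooth hαB _ (hmaps' y hy))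
      rw [Homeomorph.symm_trans_apply, Homeomorph.apply_symm_apply] at h1
      exact h1.comp y (shear hC hβB y hy)
    · exact off hfix' y hy

end Shear

end KostlanStability

/-! ### Local absorption of perturbations and extension to the sphere -/

namespace KostlanStability

open Set Filter Topology
open scoped NNReal

/-- Near a regular point, small perturbations of a function are absorbed by diffeomorphisms. -/
theorem exists_homeomorph_of_fderiv_ne_zero {E : Type*} [NormedAddCommGroup E] [NormedSpace ℝ E]
    [FiniteDimensional ℝ E] {k : WithTop ℕ∞} (hk : 1 ≤ k) {F : E → ℝ} (hF : ContDiff ℝ k F)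
    {y₀ : E} (h₀ : fderiv ℝ F y₀ ≠ 0) :
    ∃ r > 0, ∀ G H : E → ℝ, ContDiff ℝ k G → ContDiff ℝ k H → ∀ K : Set E, IsCompact K →
      K ⊆ Metric.ball y₀ r → (∀ y ∉ K, H y = 0) → ∀ᶠ ε : ℝ in 𝓝 0, ∃ Φ : E ≃ₜ E,
        ContDiff ℝ k Φ ∧ ContDiff ℝ k Φ.symm ∧ (∀ y ∉ K, Φ y = y) ∧
        ∀ y ∈ K, F (Φ y) + ε * G (Φ y) + ε * H (Φ y) = F y + ε * G y := by
  have hk0 : k ≠ 0 := (zero_lt_one.trans_le hk).ne'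
  set ℓ := fderiv ℝ F y₀ with hℓ
  obtain ⟨v, hv⟩ : ∃ v, ℓ v ≠ 0 := by
    by_contra! h
    exact h₀ (ContinuousLinearMap.ext h)
  obtain ⟨w, hw⟩ : ∃ w, ℓ w = 1 := ⟨(ℓ v)⁻¹ • v, by simp [hv]⟩
  -- One `c` bounds the nonlinear part of `F` and another the ε-terms; the factor 4 keeps `2 * c *
  -- ‖w‖ < 1`. The radius depends on `F` alone, so a cover can be fixed before `G` and `H`.
  set c : ℝ≥0 := (4 * (‖w‖₊ + 1))⁻¹ with hc
  have hcpos : 0 < c := by positivity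
  have hstrict : HasStrictFDerivAt F ℓ y₀ := hF.contDiffAt.hasStrictFDerivAt hk0
  obtain ⟨s, hs, hFs⟩ := hstrict.approximates_deriv_on_nhds (Or.inr hcpos)
  obtain ⟨r, hr, hrs⟩ := Metric.mem_nhds_iff.1 hs
  refine ⟨r, hr, fun G H hG hH K hK hKr hHK => ?_⟩
  obtain ⟨cG, hcG⟩ := hG.contDiffOn.exists_lipschitzOnWith hk0 (convex_closedBall y₀ r)
    (isCompact_closedBall y₀ r)
  have hHs : HasCompactSupport H := HasCompactSupport.intro hK hHK
  obtain ⟨cH, hcH⟩ := ContDiff.lipschitzWith_of_hasCompactSupport hHs hH hk0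
  have hlim : Tendsto (fun ε : ℝ => ‖ε‖₊ * (cG + cH)) (𝓝 0) (𝓝 0) := by
    have : Continuous fun ε : ℝ => ‖ε‖₊ * (cG + cH) := by fun_prop
    simpa using this.tendsto 0
  filter_upwards [hlim.eventually (gt_mem_nhds hcpos)] with ε hε
  have hFl : LipschitzOnWith c (F - (ℓ : E → ℝ)) (Metric.ball y₀ r) := (hFs.mono_set hrs).lipschitzOnWith
  have hεG : LipschitzOnWith (‖ε‖₊ * cG) (ε • G) (Metric.ball y₀ r) :=
    (lipschitzWith_smul ε).comp_lipschitzOnWith (hcG.mono Metric.ball_subset_closedBall)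
  -- On the ball α = F - ℓ + εG. As ℓ w = 1, the shear by α pulls ℓ back to F + εG there, and the
  -- shear by α + εH pulls it back to F + εG + εH.
  obtain ⟨α, hα, hαs⟩ := (hFl.add hεG).extend_real
  have hβ : LipschitzWith (c + ‖ε‖₊ * cG + ‖ε‖₊ * cH) (α + ε • H) :=
    hα.add ((lipschitzWith_smul ε).comp hcH)
  have hαB : ContDiffOn ℝ k α (Metric.ball y₀ r) := by
    refine ContDiffOn.congr ?_ (fun y hy => (hαs hy).symm)
    exact ((hF.sub ℓ.contDiff).add (hG.const_smul ε)).contDiffOn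
  have hβB : ContDiffOn ℝ k (α + ε • H) (Metric.ball y₀ r) :=
    hαB.add (hH.const_smul ε).contDiffOn
  have hsmall : (c + ‖ε‖₊ * cG + ‖ε‖₊ * cH) * ‖w‖₊ < 1 := by
    have h1 : c + ‖ε‖₊ * cG + ‖ε‖₊ * cH ≤ 2 * c := by
      rw [add_assoc, ← mul_add, two_mul]
      gcongr
    have h2 : c * (4 * (‖w‖₊ + 1)) = 1 := inv_mul_cancel₀ (by positivity)
    calc (c + ‖ε‖₊ * cG + ‖ε‖₊ * cH) * ‖w‖₊ ≤ 2 * c * ‖w‖₊ := by gcongr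
      _ < c * (4 * (‖w‖₊ + 1)) := by
        rw [mul_comm 2 c, mul_assoc]
        gcongr c * ?_
        rw [← NNReal.coe_lt_coe]
        push_cast
        linarith [norm_nonneg w]
      _ = 1 := h2
  obtain ⟨Φ, hΦ, h1, h2, h3, h4⟩ := exists_homeomorph_of_shears
    (hα.weaken (le_add_of_nonneg_right zero_le)) hβ hsmall hK.isClosed Metric.isOpen_ball hKr
    hk hαB hβB (fun y hy => by simp [hHK y hy])
  refine ⟨Φ, h1, h2, h3, fun y hy => ?_⟩
  have h5 := congrArg ℓ (hΦ y)
  have h6 := hαs (hKr hy)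
  have h7 := hαs (hKr (h4 y hy))
  simp only [map_add, map_smul, hw, Pi.add_apply, Pi.smul_apply, Pi.sub_apply, smul_eq_mul,
    mul_one] at h5 h6 h7
  linarith

/-- The charts are stereographic projections, onto the whole model space. -/
theorem chartAt_sph_target {n : ℕ} (x : Sph n) :
    (chartAt (EuclideanSpace ℝ (Fin n)) x).target = univ :=
  have := Fact.mk (@finrank_euclideanSpace_fin ℝ _ (n + 1))
  stereographic'_target _

/-- A compactly supported diffeomorphism of a chart extends to the sphere by the identity. -/
theorem exists_diffeomorph_of_chart {n : ℕ} {k : WithTop ℕ∞} (x₀ : Sph n)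
    (Φ : EuclideanSpace ℝ (Fin n) ≃ₜ EuclideanSpace ℝ (Fin n)) (hΦ : ContDiff ℝ k Φ)
    (hΦ' : ContDiff ℝ k Φ.symm) {K : Set (EuclideanSpace ℝ (Fin n))} (hK : IsCompact K)
    (hΦK : ∀ y ∉ K, Φ y = y) :
    ∃ φ : Diffeomorph (𝓡 n) (𝓡 n) (Sph n) (Sph n) k,
      (∀ x ∈ (chartAt (EuclideanSpace ℝ (Fin n)) x₀).source,
        φ x = (chartAt (EuclideanSpace ℝ (Fin n)) x₀).symm
          (Φ (chartAt (EuclideanSpace ℝ (Fin n)) x₀ x))) ∧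
      ∀ x ∉ (chartAt (EuclideanSpace ℝ (Fin n)) x₀).source, φ x = x := by
  classical
  set e := chartAt (EuclideanSpace ℝ (Fin n)) x₀ with he
  have htarget : e.target = univ := chartAt_sph_target x₀
  have hright : ∀ y, e (e.symm y) = y := fun y => e.right_inv (by rw [htarget]; trivial)
  have hmem : ∀ y, e.symm y ∈ e.source := fun y => e.map_target (by rw [htarget]; trivial)
  have hec : ContMDiffOn (𝓡 n) (𝓡 n) k e e.source := contMDiffOn_chart
  have hes : ContMDiff (𝓡 n) (𝓡 n) k e.symm := by
    have := contMDiffOn_chart_symm (I := 𝓡 n) (n := k) (x := x₀)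
    rwa [← he, htarget, contMDiffOn_univ] at this
  let T : (EuclideanSpace ℝ (Fin n) → EuclideanSpace ℝ (Fin n)) → Sph n → Sph n := fun Ψ x =>
    if x ∈ e.source then e.symm (Ψ (e x)) else x
  have hTin : ∀ Ψ, ∀ x ∈ e.source, T Ψ x = e.symm (Ψ (e x)) := fun Ψ x hx => if_pos hx
  have hTout : ∀ Ψ, ∀ x ∉ e.source, T Ψ x = x := fun Ψ x hx => if_neg hx
  have hT : ∀ Ψ, ContDiff ℝ k Ψ → (∀ y ∉ K, Ψ y = y) → ContMDiff (𝓡 n) (𝓡 n) k (T Ψ) := by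
    intro Ψ hΨ hΨK x
    by_cases hx : x ∈ e.source
    · have h1 : ContMDiffAt (𝓡 n) (𝓡 n) k (fun x => e.symm (Ψ (e x))) x :=
        hes.contMDiffAt.comp x (hΨ.contMDiff.contMDiffAt.comp x
          (hec.contMDiffAt (e.open_source.mem_nhds hx)))
      refine h1.congr_of_eventuallyEq ?_
      filter_upwards [e.open_source.mem_nhds hx] with z hz using hTin Ψ z hz
    -- Compactness of `K` keeps its image away from the points missed by the chart, so the map is
    -- the identity near them.
    · have hcl : IsClosed (e.symm '' K) := (hK.image hes.continuous).isClosed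
      have hxK : x ∉ e.symm '' K := by
        rintro ⟨y, -, rfl⟩
        exact hx (hmem y)
      refine contMDiffAt_id.congr_of_eventuallyEq ?_
      filter_upwards [hcl.isOpen_compl.mem_nhds hxK] with z hz
      by_cases hzs : z ∈ e.source
      · rw [hTin Ψ z hzs, hΨK, e.left_inv hzs, id]
        exact fun h => hz ⟨e z, h, e.left_inv hzs⟩
      · exact hTout Ψ z hzs
  have hinv : ∀ Ψ Ψ', (∀ y, Ψ' (Ψ y) = y) → ∀ x, T Ψ' (T Ψ x) = x := by
    intro Ψ Ψ' h x
    by_cases hx : x ∈ e.source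
    · rw [hTin Ψ x hx, hTin Ψ' _ (hmem _), hright, h, e.left_inv hx]
    · rw [hTout Ψ x hx, hTout Ψ' x hx]
  have hΦK' : ∀ y ∉ K, Φ.symm y = y := fun y hy => by
    rw [Homeomorph.symm_apply_eq, hΦK y hy]
  exact ⟨{ toFun := T Φ
           invFun := T Φ.symm
           left_inv := hinv _ _ Φ.symm_apply_apply
           right_inv := hinv _ _ Φ.apply_symm_apply
           contMDiff_toFun := hT _ hΦ hΦK
           contMDiff_invFun := hT _ hΦ' hΦK' }, hTin Φ, hTout Φ⟩

end KostlanStability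

/-! ### From local to global perturbations -/

namespace KostlanStability

open Set Filter Topology
open scoped NNReal

theorem DiffeomorphicPairs.refl {n : ℕ} (k : ℕ∞) (Z : Set (Sph n)) : DiffeomorphicPairs k Z Z :=
  ⟨Diffeomorph.refl _ _ _, by simp⟩

theorem DiffeomorphicPairs.symm {n : ℕ} {k : ℕ∞} {Z₁ Z₂ : Set (Sph n)}
    (h : DiffeomorphicPairs k Z₁ Z₂) : DiffeomorphicPairs k Z₂ Z₁ := by
  obtain ⟨φ, rfl⟩ := h
  exact ⟨φ.symm, by simp [image_image]⟩

theorem DiffeomorphicPairs.trans {n : ℕ} {k : ℕ∞} {Z₁ Z₂ Z₃ : Set (Sph n)}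
    (h : DiffeomorphicPairs k Z₁ Z₂) (h' : DiffeomorphicPairs k Z₂ Z₃) :
    DiffeomorphicPairs k Z₁ Z₃ := by
  obtain ⟨φ, rfl⟩ := h
  obtain ⟨ψ, rfl⟩ := h'
  exact ⟨φ.trans ψ, by simp [image_image]⟩

theorem diffeomorphicPairs_zeroSet {n : ℕ} {k : ℕ∞} {f g : Sph n → ℝ}
    (φ : Diffeomorph (𝓡 n) (𝓡 n) (Sph n) (Sph n) (k : WithTop ℕ∞))
    (h : ∀ x, g (φ x) = f x) : DiffeomorphicPairs k (zeroSet f) (zeroSet g) := by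
  refine ⟨φ, ?_⟩
  ext y
  constructor
  · rintro ⟨x, hx, rfl⟩
    exact (h x).trans hx
  · intro hy
    refine ⟨φ.symm y, ?_, φ.apply_symm_apply y⟩
    change f (φ.symm y) = 0
    rw [← h, φ.apply_symm_apply]
    exact hy

theorem exists_bound_of_continuous_sph {n : ℕ} {g : Sph n → ℝ} (hg : Continuous g) :
    ∃ C, ∀ x, |g x| ≤ C := by
  obtain ⟨C, hC⟩ := isCompact_univ.exists_bound_of_continuousOn hg.continuousOn
  exact ⟨C, fun x => hC x trivial⟩

/-- Where `h` is nonzero, `|f|` exceeds `c` and neither perturbed function vanishes for small ε;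
elsewhere the two agree. The zero sets are thus equal. -/
theorem eventually_diffeomorphicPairs_of_ne_zero {n : ℕ} {k : ℕ∞} {f g h : Sph n → ℝ} {c : ℝ}
    (hc : 0 < c) (hg : Continuous g) (hh : Continuous h) (hs : ∀ x, h x ≠ 0 → c < |f x|) :
    ∀ᶠ ε : ℝ in 𝓝 0, DiffeomorphicPairs k (zeroSet fun x => f x + ε * g x)
      (zeroSet fun x => f x + ε * g x + ε * h x) := by
  obtain ⟨A, hA⟩ := exists_bound_of_continuous_sph hg
  obtain ⟨B, hB⟩ := exists_bound_of_continuous_sph hh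
  have hlim : Tendsto (fun ε : ℝ => |ε| * A + |ε| * B) (𝓝 0) (𝓝 0) := by
    have : Continuous fun ε : ℝ => |ε| * A + |ε| * B := by fun_prop
    simpa using this.tendsto 0
  filter_upwards [hlim.eventually (gt_mem_nhds hc)] with ε hε
  suffices h : (zeroSet fun x => f x + ε * g x) = zeroSet fun x => f x + ε * g x + ε * h x by
    rw [h]
    exact .refl _ _
  ext x
  change f x + ε * g x = 0 ↔ f x + ε * g x + ε * h x = 0
  by_cases hx : h x = 0
  · simp [hx]
  have h1 : |ε * g x| ≤ |ε| * A := by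
    rw [abs_mul]
    exact mul_le_mul_of_nonneg_left (hA x) (abs_nonneg _)
  have h2 : |ε * h x| ≤ |ε| * B := by
    rw [abs_mul]
    exact mul_le_mul_of_nonneg_left (hB x) (abs_nonneg _)
  have h3 := hs x hx
  have h4 := abs_nonneg (ε * h x)
  constructor
  · intro h0
    have h5 : |f x| = |ε * g x| := by rw [← abs_neg (ε * g x)]; congr 1; linarith
    linarith
  · intro h0
    have h5 : |f x| = |ε * g x + ε * h x| := by
      rw [← abs_neg (ε * g x + ε * h x)]; congr 1; linarith
    linarith [abs_add_le (ε * g x) (ε * h x)]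

theorem contDiff_comp_chartAt_symm {n : ℕ} {k : WithTop ℕ∞} {f : Sph n → ℝ}
    (hf : ContMDiff (𝓡 n) 𝓘(ℝ, ℝ) k f) (x : Sph n) :
    ContDiff ℝ k (f ∘ (chartAt (EuclideanSpace ℝ (Fin n)) x).symm) := by
  have h := contMDiffOn_chart_symm (I := 𝓡 n) (n := k) (x := x)
  rw [chartAt_sph_target, contMDiffOn_univ] at h
  exact (hf.comp h).contDiff

theorem fderiv_comp_chartAt_symm_ne_zero {n : ℕ} {f : Sph n → ℝ} {x : Sph n}
    (h : mfderiv (𝓡 n) 𝓘(ℝ, ℝ) f x ≠ 0) :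
    fderiv ℝ (f ∘ (chartAt (EuclideanSpace ℝ (Fin n)) x).symm)
      (chartAt (EuclideanSpace ℝ (Fin n)) x x) ≠ 0 := by
  intro h0
  apply h
  by_cases hd : MDifferentiableAt (𝓡 n) 𝓘(ℝ, ℝ) f x
  · rw [hd.mfderiv, writtenInExtChartAt]
    simp only [mfld_simps, fderivWithin_univ]
    exact h0
  -- The default value of `mfderiv` is 0.
  · exact mfderiv_zero_of_not_mdifferentiableAt hd

/-- Near a point which is not a singular zero of `f`, small perturbations of `f` do not change
the diffeomorphism type of the zero set. -/
theorem exists_isOpen_eventually_diffeomorphicPairs {n : ℕ} {k : ℕ∞} (hk : 1 ≤ k)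
    {f : Sph n → ℝ} (hf : ContMDiff (𝓡 n) 𝓘(ℝ, ℝ) (k : WithTop ℕ∞) f) (x₀ : Sph n)
    (hreg : f x₀ = 0 → mfderiv (𝓡 n) 𝓘(ℝ, ℝ) f x₀ ≠ 0) :
    ∃ U : Set (Sph n), IsOpen U ∧ x₀ ∈ U ∧ ∀ g h : Sph n → ℝ,
      ContMDiff (𝓡 n) 𝓘(ℝ, ℝ) (k : WithTop ℕ∞) g → ContMDiff (𝓡 n) 𝓘(ℝ, ℝ) (k : WithTop ℕ∞) h →
      tsupport h ⊆ U → ∀ᶠ ε : ℝ in 𝓝 0, DiffeomorphicPairs k (zeroSet fun x => f x + ε * g x)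
        (zeroSet fun x => f x + ε * g x + ε * h x) := by
  by_cases hx : f x₀ = 0
  swap
  · have hpos : 0 < |f x₀| := abs_pos.2 hx
    refine ⟨{x | |f x₀| / 2 < |f x|}, isOpen_lt continuous_const hf.continuous.abs,
      half_lt_self hpos, fun g h hg hh hs => ?_⟩
    exact eventually_diffeomorphicPairs_of_ne_zero (half_pos hpos) hg.continuous hh.continuous
      fun x hx => hs (subset_tsupport _ hx)
  set e := chartAt (EuclideanSpace ℝ (Fin n)) x₀ with he
  have htarget : e.target = univ := chartAt_sph_target x₀
  have hright : ∀ y, e (e.symm y) = y := fun y => e.right_inv (by rw [htarget]; trivial)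
  have hmem : ∀ y, e.symm y ∈ e.source := fun y => e.map_target (by rw [htarget]; trivial)
  have hk' : (1 : WithTop ℕ∞) ≤ k := by exact_mod_cast hk
  obtain ⟨r, hr, H⟩ := exists_homeomorph_of_fderiv_ne_zero hk' (contDiff_comp_chartAt_symm hf x₀)
    (fderiv_comp_chartAt_symm_ne_zero (hreg hx))
  rw [← he] at H
  refine ⟨e.source ∩ e ⁻¹' Metric.ball (e x₀) r, e.isOpen_inter_preimage Metric.isOpen_ball,
    ⟨mem_chart_source _ x₀, Metric.mem_ball_self hr⟩, fun g h hg hh hs => ?_⟩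
  have hsource : tsupport h ⊆ e.source := fun x hx => (hs hx).1
  have hKc : IsCompact (e '' tsupport h) :=
    (isClosed_tsupport h).isCompact.image_of_continuousOn (e.continuousOn.mono hsource)
  have hKb : e '' tsupport h ⊆ Metric.ball (e x₀) r := by
    rintro _ ⟨x, hx, rfl⟩
    exact (hs hx).2
  have hK0 : ∀ y ∉ e '' tsupport h, (h ∘ e.symm) y = 0 := fun y hy => by
    by_contra h0
    exact hy ⟨e.symm y, subset_tsupport _ h0, hright y⟩
  filter_upwards [H _ _ (contDiff_comp_chartAt_symm hg x₀) (contDiff_comp_chartAt_symm hh x₀) _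
    hKc hKb hK0] with ε ⟨Φ, h1, h2, h3, h4⟩
  obtain ⟨φ, hφ, hφ'⟩ := exists_diffeomorph_of_chart x₀ Φ h1 h2 hKc h3
  rw [← he] at hφ hφ'
  refine diffeomorphicPairs_zeroSet φ fun x => ?_
  by_cases hxK : x ∈ tsupport h
  · have hxs := hsource hxK
    have h5 := h4 _ (mem_image_of_mem e hxK)
    simp only [Function.comp_apply, ← he, e.left_inv hxs] at h5
    rw [hφ x hxs]
    exact h5
  · have hfix : φ x = x := by
      by_cases hxs : x ∈ e.source
      · rw [hφ x hxs, h3, e.left_inv hxs]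
        rintro ⟨z, hz, hzx⟩
        exact hxK (e.injOn (hsource hz) hxs hzx ▸ hz)
      · exact hφ' x hxs
    rw [hfix, image_eq_zero_of_notMem_tsupport hxK]
    ring

/-- Small perturbations of a function with no singular zeros have diffeomorphic zero sets. -/
theorem eventually_diffeomorphicPairs {n : ℕ} {k : ℕ∞} (hk : 1 ≤ k)
    {f h : Sph n → ℝ} (hf : ContMDiff (𝓡 n) 𝓘(ℝ, ℝ) (k : WithTop ℕ∞) f)
    (hh : ContMDiff (𝓡 n) 𝓘(ℝ, ℝ) (k : WithTop ℕ∞) h)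
    (hreg : ∀ x, f x = 0 → mfderiv (𝓡 n) 𝓘(ℝ, ℝ) f x ≠ 0) :
    ∀ᶠ ε : ℝ in 𝓝 0, DiffeomorphicPairs k (zeroSet f) (zeroSet fun x => f x + ε * h x) := by
  classical
  choose U hUo hxU hU using
    fun x => exists_isOpen_eventually_diffeomorphicPairs hk hf x (hreg x)
  obtain ⟨t, ht⟩ := isCompact_univ.elim_finite_subcover U hUo fun x _ =>
    mem_iUnion.2 ⟨x, hxU x⟩
  obtain ⟨ρ, hρ⟩ := SmoothPartitionOfUnity.exists_isSubordinate (𝓡 n) isClosed_univ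
    (fun i : t => U i) (fun i => hUo i) (by simpa [iUnion_subtype] using ht)
  have hρs : ∀ i, ContMDiff (𝓡 n) 𝓘(ℝ, ℝ) (k : WithTop ℕ∞) fun x => ρ i x * h x := fun i =>
    ((ρ i).contMDiff.of_le (by exact_mod_cast le_top)).mul hh
  have hsum : ∀ x, ∑ i, ρ i x * h x = h x := fun x => by
    rw [← Finset.sum_mul, ← finsum_eq_sum_of_fintype, ρ.sum_eq_one (mem_univ x), one_mul]
  -- The pieces ρ i * h are added one at a time; those already added play the role of `g` in the
  -- local statement.
  have key : ∀ s : Finset t, ∀ᶠ ε : ℝ in 𝓝 0, DiffeomorphicPairs k (zeroSet f)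
      (zeroSet fun x => f x + ε * ∑ i ∈ s, ρ i x * h x) := by
    intro s
    induction s using Finset.induction_on with
    | empty => simpa using DiffeomorphicPairs.refl k (zeroSet f)
    | insert i s hi ih =>
      have hg : ContMDiff (𝓡 n) 𝓘(ℝ, ℝ) (k : WithTop ℕ∞) fun x => ∑ i ∈ s, ρ i x * h x :=
        contMDiff_finsetSum fun i _ => hρs i
      have hts : tsupport (fun x => ρ i x * h x) ⊆ U i :=
        (tsupport_mul_subset_left).trans (hρ i)
      filter_upwards [ih, hU i _ _ hg (hρs i) hts] with ε h1 h2
      convert h1.trans h2 using 3 with x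
      rw [Finset.sum_insert hi]
      ring
  simpa only [hsum] using key Finset.univ

/-- If no function of the segment from `f` to `f + h` has a singular zero, then the zero sets of
`f` and `f + h` are diffeomorphic. -/
theorem diffeomorphicPairs_of_segment {n : ℕ} {k : ℕ∞} (hk : 1 ≤ k)
    {f h : Sph n → ℝ} (hf : ContMDiff (𝓡 n) 𝓘(ℝ, ℝ) (k : WithTop ℕ∞) f)
    (hh : ContMDiff (𝓡 n) 𝓘(ℝ, ℝ) (k : WithTop ℕ∞) h)
    (hreg : ∀ t ∈ Icc (0 : ℝ) 1, ∀ x, f x + t * h x = 0 →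
      mfderiv (𝓡 n) 𝓘(ℝ, ℝ) (fun x => f x + t * h x) x ≠ 0) :
    DiffeomorphicPairs k (zeroSet f) (zeroSet fun x => f x + h x) := by
  -- Being diffeomorphic is an equivalence relation on parameters, and every parameter is related to
  -- all nearby ones.
  have key := (isPreconnected_Icc (a := (0 : ℝ)) (b := 1)).induction₂
    (fun s t => DiffeomorphicPairs k (zeroSet fun x => f x + s * h x)
      (zeroSet fun x => f x + t * h x)) (fun s hs => ?_)
    (fun _ _ _ _ _ _ h1 h2 => h1.trans h2) (fun _ _ _ _ h1 => h1.symm)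
    (left_mem_Icc.2 zero_le_one) (right_mem_Icc.2 zero_le_one)
  · simpa using key
  · have hfs : ContMDiff (𝓡 n) 𝓘(ℝ, ℝ) (k : WithTop ℕ∞) fun x => f x + s * h x :=
      hf.add (contMDiff_const.mul hh)
    have hlim : Tendsto (fun t : ℝ => t - s) (𝓝[Icc 0 1] s) (𝓝 0) := by
      have : Continuous fun t : ℝ => t - s := by fun_prop
      simpa using (this.tendsto s).mono_left nhdsWithin_le_nhds
    filter_upwards [hlim.eventually (eventually_diffeomorphicPairs hk hfs hh (hreg s hs))]
      with t ht
    convert ht using 3 with x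
    ring

end KostlanStability

/-! ### Calculus of the spherical gradient -/

namespace KostlanStability

open Set Filter Topology

/-- The radial projection `y ↦ y / ‖y‖` to the sphere, with the value `x₀` at the origin. -/
noncomputable def radialProj {n : ℕ} (x₀ : Sph n) (y : Ambient n) : Sph n :=
  if hy : y ≠ 0 then ⟨‖y‖⁻¹ • y, by
    simp [norm_smul, inv_mul_cancel₀ (norm_ne_zero_iff.mpr hy)]⟩ else x₀

theorem coe_ne_zero {n : ℕ} (x : Sph n) : (x : Ambient n) ≠ 0 := by
  intro h
  have hx1 : ‖(x : Ambient n)‖ = 1 := by simp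
  simp [h] at hx1

theorem radialProj_coe {n : ℕ} (x₀ x : Sph n) : radialProj x₀ (x : Ambient n) = x := by
  ext1
  simp [radialProj, coe_ne_zero x]

theorem radialExtension_eventuallyEq {n : ℕ} (f : Sph n → ℝ) (x₀ : Sph n) {y : Ambient n}
    (hy : y ≠ 0) : radialExtension f =ᶠ[𝓝 y] f ∘ radialProj x₀ := by
  filter_upwards [isOpen_ne.mem_nhds hy] with z hz
  have hz' : z ≠ 0 := hz
  simp [radialExtension, radialProj, hz']

theorem contMDiffAt_radialProj {n : ℕ} (k : WithTop ℕ∞) (x₀ : Sph n) {y : Ambient n}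
    (hy : y ≠ 0) : ContMDiffAt 𝓘(ℝ, Ambient n) (𝓡 n) k (radialProj x₀) y := by
  have := Fact.mk (@finrank_euclideanSpace_fin ℝ _ (n + 1))
  let U : TopologicalSpace.Opens (Ambient n) := ⟨{y | y ≠ 0}, isOpen_ne⟩
  have hU : ∀ u : U, (u : Ambient n) ≠ 0 := fun u => u.2
  have h1 : ContMDiff 𝓘(ℝ, Ambient n) 𝓘(ℝ, Ambient n) k
      fun u : U => ‖(u : Ambient n)‖⁻¹ • (u : Ambient n) := by
    intro u
    refine (contMDiffAt_subtype_iff (f := fun z : Ambient n => ‖z‖⁻¹ • z)).2 ?_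
    exact (((contDiffAt_norm ℝ (hU u)).inv (norm_ne_zero_iff.2 (hU u))).smul
      contDiffAt_id).contMDiffAt
  have h2 : ∀ u : U, ‖(u : Ambient n)‖⁻¹ • (u : Ambient n) ∈ Metric.sphere (0 : Ambient n) 1 :=
    fun u => by simp [norm_smul, inv_mul_cancel₀ (norm_ne_zero_iff.mpr (hU u))]
  have h3 := h1.codRestrict_sphere (n := n) h2
  refine (contMDiffAt_subtype_iff (U := U) (x := ⟨y, hy⟩)).1 ?_
  refine (h3 ⟨y, hy⟩).congr_of_eventuallyEq (Eventually.of_forall fun u => ?_)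
  ext1
  simp [radialProj, hU u]

theorem contDiffAt_radialExtension {n : ℕ} {k : WithTop ℕ∞} {f : Sph n → ℝ}
    (hf : ContMDiff (𝓡 n) 𝓘(ℝ, ℝ) k f) (x : Sph n) :
    ContDiffAt ℝ k (radialExtension f) (x : Ambient n) := by
  have h := hf.contMDiffAt.comp (x : Ambient n) (contMDiffAt_radialProj k x (coe_ne_zero x))
  exact h.contDiffAt.congr_of_eventuallyEq (radialExtension_eventuallyEq f x (coe_ne_zero x))

/-- Chain rule for `f ∘ radialProj x`. This links the intrinsic singularity condition of the isotopy
argument to the gradient that defines the discriminant. -/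
theorem sphGrad_eq_zero_of_mfderiv_eq_zero {n : ℕ} {f : Sph n → ℝ} {x : Sph n}
    (hf : MDifferentiableAt (𝓡 n) 𝓘(ℝ, ℝ) f x) (h : mfderiv (𝓡 n) 𝓘(ℝ, ℝ) f x = 0) :
    sphGrad f x = 0 := by
  have hp := radialProj_coe x x
  have h1 : MDifferentiableAt 𝓘(ℝ, Ambient n) (𝓡 n) (radialProj x) (x : Ambient n) :=
    (contMDiffAt_radialProj 1 x (coe_ne_zero x)).mdifferentiableAt one_ne_zero
  have h2 : HasMFDerivAt (𝓡 n) 𝓘(ℝ, ℝ) f (radialProj x (x : Ambient n)) 0 := by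
    rw [hp, ← h]
    exact hf.hasMFDerivAt
  have h3 : HasFDerivAt (f ∘ radialProj x) (0 : Ambient n →L[ℝ] ℝ) (x : Ambient n) :=
    (h2.comp (x : Ambient n) h1.hasMFDerivAt).hasFDerivAt
  have h4 : fderiv ℝ (radialExtension f) (x : Ambient n) = 0 := by
    rw [(radialExtension_eventuallyEq f x (coe_ne_zero x)).fderiv_eq, h3.fderiv]
  rw [sphGrad, gradient, h4, map_zero]

theorem sphGrad_add_const_mul {n : ℕ} {f g : Sph n → ℝ} {k : WithTop ℕ∞} (hk : 1 ≤ k)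
    (hf : ContMDiff (𝓡 n) 𝓘(ℝ, ℝ) k f) (hg : ContMDiff (𝓡 n) 𝓘(ℝ, ℝ) k g) (t : ℝ) (x : Sph n) :
    sphGrad (fun y => f y + t * g y) x = sphGrad f x + t • sphGrad g x := by
  have hk0 : k ≠ 0 := (zero_lt_one.trans_le hk).ne'
  have h1 := (contDiffAt_radialExtension hf x).differentiableAt hk0
  have h2 := (contDiffAt_radialExtension hg x).differentiableAt hk0
  have h3 : radialExtension (fun y => f y + t * g y) =
      radialExtension f + t • radialExtension g := by
    ext y
    by_cases hy : y = 0 <;> simp [radialExtension, hy]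
  rw [sphGrad, sphGrad, sphGrad, gradient, gradient, gradient, h3,
    fderiv_add h1 (h2.const_smul t), fderiv_const_smul h2, map_add, map_smul]

theorem continuous_sphGrad {n : ℕ} {f : Sph n → ℝ} {k : WithTop ℕ∞} (hk : 1 ≤ k)
    (hf : ContMDiff (𝓡 n) 𝓘(ℝ, ℝ) k f) : Continuous (sphGrad f) := by
  rw [continuous_iff_continuousAt]
  intro x
  have h1 : ContDiffAt ℝ 1 (radialExtension f) (x : Ambient n) :=
    (contDiffAt_radialExtension hf x).of_le hk
  have h2 : ContinuousAt (fderiv ℝ (radialExtension f)) (x : Ambient n) :=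
    h1.continuousAt_fderiv one_ne_zero
  exact (InnerProductSpace.toDual ℝ (Ambient n)).symm.continuous.continuousAt.comp
    (h2.comp continuous_subtype_val.continuousAt)

theorem abs_add_norm_sphGrad_le_c1Norm {n : ℕ} {f : Sph n → ℝ} {k : WithTop ℕ∞} (hk : 1 ≤ k)
    (hf : ContMDiff (𝓡 n) 𝓘(ℝ, ℝ) k f) (x : Sph n) : |f x| + ‖sphGrad f x‖ ≤ c1Norm f :=
  add_le_add
    (le_ciSup (isCompact_range hf.continuous.abs).bddAbove x)
    (le_ciSup (isCompact_range (continuous_sphGrad hk hf).norm).bddAbove x)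

theorem contDiff_eval {n : ℕ} (P : MvPolynomial (Fin (n + 1)) ℝ) (k : WithTop ℕ∞) :
    ContDiff ℝ k fun y : Ambient n => MvPolynomial.eval (fun i => y i) P := by
  induction P using MvPolynomial.induction_on with
  | C a => simpa using contDiff_const
  | add p q hp hq => simpa using hp.add hq
  | mul_X p i hp =>
    simp only [map_mul, MvPolynomial.eval_X]
    exact hp.mul (contDiff_piLp_apply (p := 2))

theorem contMDiff_restrict {n : ℕ} (P : MvPolynomial (Fin (n + 1)) ℝ) (k : WithTop ℕ∞) :
    ContMDiff (𝓡 n) 𝓘(ℝ, ℝ) k (restrict P : Sph n → ℝ) := by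
  have := Fact.mk (@finrank_euclideanSpace_fin ℝ _ (n + 1))
  exact (contDiff_eval P k).contMDiff.comp contMDiff_coe_sphere

end KostlanStability

/-! ### Bombieri-Weil norms of products with linear forms -/

namespace KostlanStability

open MvPolynomial

/-- The linear form `⟨v, x⟩`. -/
noncomputable def linForm {n : ℕ} (v : Ambient n) : MvPolynomial (Fin (n + 1)) ℝ :=
  ∑ i, C (v i) * X i

theorem linForm_isHomogeneous {n : ℕ} (v : Ambient n) : (linForm v).IsHomogeneous 1 :=
  IsHomogeneous.sum _ _ _ fun i _ => isHomogeneous_C_mul_X _ i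

theorem eval_linForm {n : ℕ} (v y : Ambient n) :
    eval (fun i => y i) (linForm v) = inner ℝ v y := by
  simp [linForm, PiLp.inner_apply, mul_comm]

/-- Summing over all exponents of degree `d` makes the index set independent of `P`. -/
theorem bwNorm_sq_eq_sum {n d : ℕ} (P : HomPoly n d) :
    bwNorm P ^ 2 = ∑ α ∈ Finset.univ.finsuppAntidiag d,
      ((P : MvPolynomial (Fin (n + 1)) ℝ).coeff α) ^ 2 *
        ((∏ i, ((α i).factorial : ℝ)) / (d.factorial : ℝ)) := by
  rw [bwNorm, Real.sq_sqrt (Finset.sum_nonneg fun α _ => by positivity)]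
  refine Finset.sum_subset (fun α hα => ?_) (fun α _ hα => ?_)
  · rw [Finset.mem_finsuppAntidiag]
    refine ⟨?_, Finset.subset_univ _⟩
    have h1 : (P : MvPolynomial (Fin (n + 1)) ℝ).IsHomogeneous d := P.2
    have h2 := h1.degree_eq_sum_deg_support hα
    rw [h2]
    exact (Finset.sum_subset (Finset.subset_univ _) fun i _ hi => by simpa using hi).symm
  · rw [notMem_support_iff.1 hα]
    simp

theorem sum_finsuppAntidiag_succ {ι : Type*} [Fintype ι] [DecidableEq ι] (d : ℕ) (i : ι)
    (F : (ι →₀ ℕ) → ℝ) :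
    ∑ α ∈ Finset.univ.finsuppAntidiag (d + 1),
      (if i ∈ α.support then F (α - Finsupp.single i 1) else 0) =
    ∑ β ∈ Finset.univ.finsuppAntidiag d, F β := by
  have hsucc : ∀ β : ι →₀ ℕ, Finset.univ.sum (β + Finsupp.single i 1 : ι →₀ ℕ) = Finset.univ.sum β + 1 :=
    fun β => by simp [Finset.sum_add_distrib, Finsupp.single_apply]
  rw [← Finset.sum_filter]
  refine Finset.sum_nbij' (fun α => α - Finsupp.single i 1) (fun β => β + Finsupp.single i 1)
    ?_ ?_ ?_ ?_ (fun _ _ => rfl)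
  · intro α hα
    rw [Finset.mem_filter, Finset.mem_finsuppAntidiag, Finsupp.mem_support_iff] at hα
    rw [Finset.mem_finsuppAntidiag]
    refine ⟨?_, Finset.subset_univ _⟩
    have h1 : α - Finsupp.single i 1 + Finsupp.single i 1 = α :=
      tsub_add_cancel_of_le (Finsupp.single_le_iff.2 (Nat.one_le_iff_ne_zero.2 hα.2))
    have h2 := hα.1.1
    rw [← h1, hsucc] at h2
    exact Nat.succ.inj h2
  · intro β hβ
    rw [Finset.mem_finsuppAntidiag] at hβ
    rw [Finset.mem_filter, Finset.mem_finsuppAntidiag, Finsupp.mem_support_iff]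
    refine ⟨⟨?_, Finset.subset_univ _⟩, by simp⟩
    rw [hsucc, hβ.1]
  · intro α hα
    rw [Finset.mem_filter, Finsupp.mem_support_iff] at hα
    exact tsub_add_cancel_of_le (Finsupp.single_le_iff.2 (Nat.one_le_iff_ne_zero.2 hα.2))
  · intro β _
    exact add_tsub_cancel_right _ _

theorem prod_factorial_eq {n : ℕ} {α : Fin (n + 1) →₀ ℕ} {i : Fin (n + 1)} (hi : α i ≠ 0) :
    ∏ j, ((α j).factorial : ℝ) =
      α i * ∏ j, (((α - Finsupp.single i 1 : Fin (n + 1) →₀ ℕ) j).factorial : ℝ) := by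
  rw [← Finset.mul_prod_erase _ _ (Finset.mem_univ i),
    ← Finset.mul_prod_erase (a := i) _ (fun j =>
      (((α - Finsupp.single i 1 : Fin (n + 1) →₀ ℕ) j).factorial : ℝ)) (Finset.mem_univ i),
    ← mul_assoc]
  congr 1
  · rw [Finsupp.tsub_apply, Finsupp.single_eq_same]
    exact_mod_cast (Nat.mul_factorial_pred hi).symm
  · refine Finset.prod_congr rfl fun j hj => ?_
    rw [Finsupp.tsub_apply, Finsupp.single_eq_of_ne (Finset.ne_of_mem_erase hj), Nat.sub_zero]

/-- Multiplication by a linear form is bounded for the Bombieri-Weil norm. -/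
theorem bwNorm_mul_linForm_le {n d : ℕ} (Q : HomPoly n d) (v : Ambient n)
    (h : (Q : MvPolynomial (Fin (n + 1)) ℝ) * linForm v ∈ HomPoly n (d + 1)) :
    bwNorm (⟨(Q : MvPolynomial (Fin (n + 1)) ℝ) * linForm v, h⟩ : HomPoly n (d + 1)) ≤
      bwNorm Q * ‖v‖ := by
  classical
  refine le_of_sq_le_sq ?_ (mul_nonneg (Real.sqrt_nonneg _) (norm_nonneg _))
  set q := (Q : MvPolynomial (Fin (n + 1)) ℝ) with hq
  let F : (Fin (n + 1) →₀ ℕ) → ℝ := fun β =>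
    (q.coeff β) ^ 2 * ((∏ j, ((β j).factorial : ℝ)) / (d.factorial : ℝ))
  have hcoeff : ∀ α, (q * linForm v).coeff α =
      ∑ i, v i * if i ∈ α.support then q.coeff (α - Finsupp.single i 1) else 0 := by
    intro α
    rw [linForm, Finset.mul_sum, coeff_sum]
    refine Finset.sum_congr rfl fun i _ => ?_
    rw [mul_left_comm, coeff_C_mul, coeff_mul_X']
  have hbound : ∀ α ∈ Finset.univ.finsuppAntidiag (d + 1),
      ((q * linForm v).coeff α) ^ 2 *
        ((∏ j, ((α j).factorial : ℝ)) / ((d + 1).factorial : ℝ)) ≤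
      ∑ i, v i ^ 2 * if i ∈ α.support then F (α - Finsupp.single i 1) else 0 := by
    intro α hα
    rw [Finset.mem_finsuppAntidiag] at hα
    have hsum : ∑ i, (α i : ℝ) = d + 1 := by exact_mod_cast hα.1
    have hfac : ((d + 1).factorial : ℝ) = (d + 1) * d.factorial := by
      exact_mod_cast Nat.factorial_succ d
    -- Cauchy-Schwarz with weights α i, of total d + 1. The weights match the norm because (α! /
    -- (d+1)!) (d+1) / α i = (α - e_i)! / d!.
    have hcs := Finset.sum_sq_le_sum_mul_sum_of_sq_le_mul Finset.univ
      (r := fun i => v i * if i ∈ α.support then q.coeff (α - Finsupp.single i 1) else 0)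
      (f := fun i => (α i : ℝ))
      (g := fun i => if i ∈ α.support then
        v i ^ 2 * q.coeff (α - Finsupp.single i 1) ^ 2 / α i else 0)
      (fun i _ => by positivity) (fun i _ => by split_ifs <;> positivity) (fun i _ => by
        split_ifs with hi
        · have : (α i : ℝ) ≠ 0 := by exact_mod_cast Finsupp.mem_support_iff.1 hi
          refine le_of_eq ?_
          field_simp
        · simp)
    rw [← hcoeff, hsum] at hcs
    calc _ ≤ ((d + 1 : ℝ) * ∑ i, if i ∈ α.support then
            v i ^ 2 * q.coeff (α - Finsupp.single i 1) ^ 2 / α i else 0) *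
          ((∏ j, ((α j).factorial : ℝ)) / ((d + 1).factorial : ℝ)) := by gcongr
      _ = ∑ i, v i ^ 2 * if i ∈ α.support then F (α - Finsupp.single i 1) else 0 := by
        rw [Finset.mul_sum, Finset.sum_mul]
        refine Finset.sum_congr rfl fun i _ => ?_
        split_ifs with hi
        · have hi' := Finsupp.mem_support_iff.1 hi
          have h1 : (α i : ℝ) ≠ 0 := by exact_mod_cast hi'
          rw [prod_factorial_eq hi', hfac]
          simp only [F]
          field_simp
        · simp
  rw [bwNorm_sq_eq_sum, mul_pow, bwNorm_sq_eq_sum, EuclideanSpace.norm_sq_eq]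
  refine (Finset.sum_le_sum hbound).trans ?_
  rw [Finset.sum_comm]
  simp_rw [← Finset.mul_sum, sum_finsuppAntidiag_succ, ← Finset.sum_mul, Real.norm_eq_abs, sq_abs]
  rw [mul_comm]

theorem linForm_pow_mem {n : ℕ} (x : Ambient n) (m : ℕ) : linForm x ^ m ∈ HomPoly n m := by
  have := (linForm_isHomogeneous x).pow m
  rwa [one_mul] at this

theorem linForm_pow_mul_mem {n : ℕ} (x v : Ambient n) (m : ℕ) :
    linForm x ^ m * linForm v ∈ HomPoly n (m + 1) :=
  IsHomogeneous.mul (linForm_pow_mem x m) (linForm_isHomogeneous v)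

theorem bwNorm_nonneg {n d : ℕ} (P : HomPoly n d) : 0 ≤ bwNorm P := Real.sqrt_nonneg _

theorem bwNorm_C {n : ℕ} (a : ℝ) (h : C a ∈ HomPoly n 0) :
    bwNorm (⟨C a, h⟩ : HomPoly n 0) = |a| := by
  rw [← abs_of_nonneg (bwNorm_nonneg _), ← sq_eq_sq_iff_abs_eq_abs, bwNorm_sq_eq_sum]
  simp

theorem bwNorm_linForm_pow_le {n : ℕ} {x : Ambient n} (hx : ‖x‖ = 1) (m : ℕ) :
    bwNorm (⟨linForm x ^ m, linForm_pow_mem x m⟩ : HomPoly n m) ≤ 1 := by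
  induction m with
  | zero =>
    have h := bwNorm_C (n := n) 1 (by simpa using linForm_pow_mem x 0)
    simpa using h.le
  | succ m ih =>
    have h := bwNorm_mul_linForm_le ⟨linForm x ^ m, linForm_pow_mem x m⟩ x
      (linForm_pow_mul_mem x x m)
    rw [hx, mul_one] at h
    exact h.trans ih

theorem bwNorm_linForm_pow_mul_le {n : ℕ} {x : Ambient n} (hx : ‖x‖ = 1) (v : Ambient n) (m : ℕ) :
    bwNorm (⟨linForm x ^ m * linForm v, linForm_pow_mul_mem x v m⟩ : HomPoly n (m + 1)) ≤ ‖v‖ :=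
  (bwNorm_mul_linForm_le ⟨linForm x ^ m, linForm_pow_mem x m⟩ v _).trans
    (mul_le_of_le_one_left (norm_nonneg _) (bwNorm_linForm_pow_le hx m))

theorem bwNorm_neg {n d : ℕ} (P : HomPoly n d) : bwNorm (-P) = bwNorm P := by
  simp [bwNorm]

end KostlanStability

/-! ### Distance to the discriminant and conclusion -/

namespace KostlanStability

open MvPolynomial

theorem discDist_le_bwNorm {n d : ℕ} {P T : HomPoly n d} (h : P - T ∈ discriminant n d) :
    discDist P ≤ bwNorm T := by
  have h1 : bwNorm (P - T - P) = bwNorm T := by rw [sub_sub_cancel_left, bwNorm_neg]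
  rw [← h1]
  refine csInf_le ⟨0, ?_⟩ ⟨P - T, h, rfl⟩
  rintro _ ⟨S, -, rfl⟩
  exact bwNorm_nonneg _

theorem inner_sphGrad_restrict {n : ℕ} (P : MvPolynomial (Fin (n + 1)) ℝ) (x : Sph n) :
    inner ℝ (x : Ambient n) (sphGrad (restrict P) x) = 0 := by
  have h : sphGrad (restrict P) x = _ := sphGrad_restriction
    (fun y : Ambient n => eval (fun i => y i) P) x
    ((contDiff_eval P 1).differentiable one_ne_zero _)
  rw [h, inner_sub_right, inner_smul_right, real_inner_self_eq_norm_sq]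
  simp

theorem restrict_linForm_pow_mul {n : ℕ} {x : Sph n} {g : Ambient n} (a : ℝ)
    (hg : inner ℝ (x : Ambient n) g = 0) (m : ℕ) :
    restrict (linForm (x : Ambient n) ^ m * linForm (a • (x : Ambient n) + g)) x = a := by
  have hg' : inner ℝ g (x : Ambient n) = 0 := by rw [real_inner_comm, hg]
  simp [restrict, eval_linForm, inner_add_left, inner_smul_left, hg']

/-- The Euclidean gradient at `x` is m a x + (a x + g), whose tangential part is `g` because `g` is
orthogonal to `x`. -/
theorem sphGrad_restrict_linForm_pow_mul {n : ℕ} {x : Sph n} {g : Ambient n} (a : ℝ)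
    (hg : inner ℝ (x : Ambient n) g = 0) (m : ℕ) :
    sphGrad (restrict (linForm (x : Ambient n) ^ m * linForm (a • (x : Ambient n) + g))) x = g := by
  have hx : inner ℝ (x : Ambient n) (x : Ambient n) = 1 := by
    rw [real_inner_self_eq_norm_sq]
    simp
  set v : Ambient n := a • (x : Ambient n) + g with hv
  have hvx : inner ℝ v (x : Ambient n) = a := by
    rw [hv, inner_add_left, inner_smul_left, hx, real_inner_comm, hg]
    simp
  have h0 : restrict (linForm (x : Ambient n) ^ m * linForm v) = fun y : Sph n =>
      (fun y : Ambient n => inner ℝ (x : Ambient n) y ^ m * inner ℝ v y) y := by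
    ext y
    simp [restrict, eval_linForm]
  have h1 : HasFDerivAt (fun y : Ambient n => inner ℝ (x : Ambient n) y ^ m * inner ℝ v y)
      (((m : ℝ) * a) • innerSL ℝ (x : Ambient n) + innerSL ℝ v) (x : Ambient n) := by
    have hp := (((innerSL ℝ (x : Ambient n)).hasFDerivAt (x := (x : Ambient n))).pow m).mul
      ((innerSL ℝ v).hasFDerivAt (x := (x : Ambient n)))
    refine hp.congr_fderiv ?_
    ext y
    simp only [innerSL_apply_apply, hx, hvx, one_pow, add_apply,
      smul_apply, smul_eq_mul, nsmul_eq_mul]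
    ring
  have h2 : gradient (fun y : Ambient n => inner ℝ (x : Ambient n) y ^ m * inner ℝ v y)
      (x : Ambient n) = ((m : ℝ) * a) • (x : Ambient n) + v := by
    apply ext_inner_right ℝ
    intro w
    rw [gradient, InnerProductSpace.toDual_symm_apply, h1.fderiv]
    simp [inner_add_left, inner_smul_left]
  rw [h0, sphGrad_restriction _ x h1.differentiableAt, h2, hv]
  simp only [inner_add_right, inner_smul_right, hx, hg]
  module

/-- The Bombieri-Weil distance to the discriminant is bounded by the size of the `1`-jet. -/
theorem discDist_le_abs_add_norm_sphGrad {n d : ℕ} (P : HomPoly n d) (x : Sph n) :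
    discDist P ≤ |restrict (P : MvPolynomial (Fin (n + 1)) ℝ) x| +
      ‖sphGrad (restrict (P : MvPolynomial (Fin (n + 1)) ℝ)) x‖ := by
  have hx : ‖(x : Ambient n)‖ = 1 := by simp
  cases d with
  -- In degree 0 there is no linear factor to use; the constant is compared with the zero
  -- polynomial.
  | zero =>
    obtain ⟨P, hP⟩ := P
    have hP' : P.IsHomogeneous 0 := hP
    obtain ⟨a, rfl⟩ : ∃ a, P = C a := ⟨_, (totalDegree_eq_zero_iff_eq_C.1
      (Nat.le_zero.1 hP'.totalDegree_le))⟩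
    refine (discDist_le_bwNorm (T := ⟨C a, hP⟩) ?_).trans ?_
    · rw [sub_self]
      exact zero_mem_discriminant n 0
    · rw [bwNorm_C]
      simp [restrict]
  | succ m =>
    set a := restrict (P : MvPolynomial (Fin (n + 1)) ℝ) x with ha
    set g := sphGrad (restrict (P : MvPolynomial (Fin (n + 1)) ℝ)) x with hgdef
    have hg : inner ℝ (x : Ambient n) g = 0 := inner_sphGrad_restrict _ x
    let T : HomPoly n (m + 1) := ⟨_, linForm_pow_mul_mem (x : Ambient n) (a • (x : Ambient n) + g) m⟩
    have hT : restrict (T : MvPolynomial (Fin (n + 1)) ℝ) x = a := restrict_linForm_pow_mul a hg m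
    have hT' : sphGrad (restrict (T : MvPolynomial (Fin (n + 1)) ℝ)) x = g :=
      sphGrad_restrict_linForm_pow_mul a hg m
    have hsub : restrict ((P - T : HomPoly n (m + 1)) : MvPolynomial (Fin (n + 1)) ℝ) =
        fun y : Sph n => restrict (P : MvPolynomial (Fin (n + 1)) ℝ) y +
          (-1) * restrict (T : MvPolynomial (Fin (n + 1)) ℝ) y := by
      ext y
      simp [restrict]
      ring
    refine (discDist_le_bwNorm (T := T) ⟨x, ?_, ?_⟩).trans ?_
    · rw [hsub]
      simp only [hT, ← ha]
      ring
    · rw [hsub, sphGrad_add_const_mul le_rfl (contMDiff_restrict _ 1) (contMDiff_restrict _ 1), hT',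
        ← hgdef]
      simp
    · calc bwNorm T ≤ ‖a • (x : Ambient n) + g‖ := bwNorm_linForm_pow_mul_le hx _ m
        _ ≤ ‖a • (x : Ambient n)‖ + ‖g‖ := norm_add_le _ _
        _ = |a| + ‖g‖ := by rw [norm_smul, hx, mul_one, Real.norm_eq_abs]

end KostlanStability

theorem mainTheorem5 (n d : ℕ) (P : HomPoly n d) (hP : P ∉ discriminant n d)
    (k : ℕ∞) (hk : 1 ≤ k) (f : Sph n → ℝ)
    (hf : ContMDiff (𝓡 n) 𝓘(ℝ, ℝ) (k : WithTop ℕ∞) f)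
    (hfP : c1Norm (fun x => f x - restrict (P : MvPolynomial (Fin (n + 1)) ℝ) x)
      < discDist P / 2) :
    DiffeomorphicPairs k (zeroSet (restrict (P : MvPolynomial (Fin (n + 1)) ℝ)))
      (zeroSet f) := by
  have hk' : (1 : WithTop ℕ∞) ≤ k := by exact_mod_cast hk
  set p : Sph n → ℝ := restrict (P : MvPolynomial (Fin (n + 1)) ℝ) with hp
  set h : Sph n → ℝ := fun x => f x - p x with hh
  have hps : ContMDiff (𝓡 n) 𝓘(ℝ, ℝ) (k : WithTop ℕ∞) p := contMDiff_restrict _ _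
  have hhs : ContMDiff (𝓡 n) 𝓘(ℝ, ℝ) (k : WithTop ℕ∞) h := hf.sub hps
  have hfh : (fun x => p x + h x) = f := by
    ext x
    simp [hh]
  have key := diffeomorphicPairs_of_segment hk hps hhs fun t ht x hx h0 => ?_
  · rwa [hfh] at key
  have hts : ContMDiff (𝓡 n) 𝓘(ℝ, ℝ) (k : WithTop ℕ∞) fun x => p x + t * h x :=
    hps.add (contMDiff_const.mul hhs)
  have h1 := sphGrad_eq_zero_of_mfderiv_eq_zero
    (hts.mdifferentiable (zero_lt_one.trans_le hk').ne' x) h0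
  rw [sphGrad_add_const_mul hk' hps hhs, add_eq_zero_iff_eq_neg] at h1
  have h2 : |p x| ≤ |h x| := by
    rw [eq_neg_of_add_eq_zero_left hx, abs_neg, abs_mul, abs_of_nonneg ht.1]
    exact mul_le_of_le_one_left (abs_nonneg _) ht.2
  have h3 : ‖sphGrad p x‖ ≤ ‖sphGrad h x‖ := by
    rw [h1, norm_neg, norm_smul, Real.norm_of_nonneg ht.1]
    exact mul_le_of_le_one_left (norm_nonneg _) ht.2
  have h4 := abs_add_norm_sphGrad_le_c1Norm hk' hhs x
  have h5 := discDist_le_abs_add_norm_sphGrad P x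
  rw [← hp] at h5
  -- The chain is δ ≤ |p x| + ‖∇p x‖ ≤ |h x| + ‖∇h x‖ ≤ ‖h‖ < δ/2, absurd since ‖h‖ ≥ 0.
  linarith [abs_nonneg (h x), norm_nonneg (sphGrad h x)]
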